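/- Let $n\ge 2$ and let $\psi=\Gamma'/\Gamma$ be the digamma function on $(0,\infty)$, which maps $(0,\infty)$ bijectively onto $\mathbb{R}$, with inverse $\psi^{-1}$. For $R=(R_1,\dots,R_n)$, $C=(C_1,\dots,C_n)\in\mathbb{R}^n$, the ML equations in the unknown $\theta=(a,b)=(a_1,\dots,a_n,b_1,\dots,b_n)\in(0,\infty)^{2n}$ are $$\sum_{j\ne i}\psi(a_i+b_j)-(n-1)\psi(a_i)+R_i=0\quad(i=1,\dots,n),\qquad \sum_{i\ne j}\psi(a_i+b_j)-(n-1)\psi(b_j)+C_j=0\quad(j=1,\dots,n).$$ Let $f=(g,h)$ be the map $$g_i(a,b)=\psi^{-1}\Big[\tfrac{1}{n-1}R_i+\tfrac1{n-1}\sum_{j\ne i}\psi(a_i+b_j)\Big],\qquad h_j(a,b)=\psi^{-1}\Big[\tfrac{1}{n-1}C_j+\tfrac1{n-1}\sum_{i\ne j}\psi(a_i+b_j)\Big],$$ and let $M=\max\{\max_i(-R_i/(n-1)),\max_i(-C_i/(n-1))\}$. (1) Let $n\ge 3$ and let $W=(w_{ij})$ be a random $n\times n$ matrix with zero diagonal whose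 off-diagonal entries are independent, $w_{ij}$ having the beta distribution with parameters $a_i>0$ and $b_j>0$. With $R_i=\sum_{j\ne i}\ln w_{ij}$ and $C_j=\sum_{i\ne j}\ln(1-w_{ij})$, the ML equations have exactly one solution in $(0,\infty)^{2n}$ with probability $1$. (2) Let $n\ge2$ and let $R,C\in\mathbb{R}^n$ be such that the ML equations have a solution $\hat\theta=(\hat a,\hat b)\in(0,\infty)^{2n}$. Then this solution is unique; there is exactly one $\varepsilon>0$ with $\psi(2\varepsilon)-\psi(\varepsilon)=M$; and the sequence $\theta^{(0)}=\varepsilon\mathbf 1=(\varepsilon,\dots,\varepsilon)\in\mathbb{R}^{2n}$, $\theta^{(k)}=f(\theta^{(k-1)})$ $(k\ge1)$ is coordinatewise (weakly) increasing, is bounded above coordinatewise by $\hat\theta$, and converges to $\hat\theta$ at a geometric rate: there are constants $K$ and $0<q<1$ with $\max_{1\le m\le 2n}|\theta^{(k)}_m-\hat\theta_m|\le Kq^k$ for all $k\ge0$. In particular, for $n\ge3$, all conclusions in (2) hold with probability $1$ for $(R,C)$ computed from the random matrix $W$. -/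

import Mathlib

open MeasureTheory ProbabilityTheory Filter Topology

namespace BetaGraph

/-- The digamma function `ψ(x) = Γ'(x) / Γ(x)`; only its values at `x > 0` are used. -/
noncomputable def digamma (x : ℝ) : ℝ := logDeriv Real.Gamma x

/-- The inverse of the digamma function `ψ : (0, ∞) → ℝ`: the point of `(0, ∞)` at which `ψ`
takes the value `y`. -/
noncomputable def digammaInv (y : ℝ) : ℝ := Function.invFunOn digamma (Set.Ioi 0) y

/-- The parameter vectors `θ = (a, b)`, with `a, b ∈ ℝⁿ`. The order is coordinatewise, and the
norm is the maximum norm of `ℝ²ⁿ`. -/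
abbrev Param (n : ℕ) : Type := (Fin n → ℝ) × (Fin n → ℝ)

/-- The random directed graph with beta-distributed edge-weights: the diagonal weights are `0`,
the weights of the edges `i → j` with `i ≠ j` are independent, and the weight of `i → j` has the
beta distribution with parameters `a i > 0` and `b j > 0`. -/
structure IsBetaModel {Ω : Type*} [MeasurableSpace Ω] {n : ℕ} (P : Measure Ω)
    (a b : Fin n → ℝ) (W : Fin n → Fin n → Ω → ℝ) : Prop where
  a_pos : ∀ i, 0 < a i
  b_pos : ∀ j, 0 < b j
  diag : ∀ i ω, W i i ω = 0
  law : ∀ i j, i ≠ j → HasLaw (W i j) (betaMeasure (a i) (b j)) P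
  indep : iIndepFun (fun e : {e : Fin n × Fin n // e.1 ≠ e.2} => W e.1.1 e.1.2) P

/-- The row-sums `R i = ∑_{j ≠ i} ln w_ij`. -/
noncomputable def rowStat {n : ℕ} (w : Fin n → Fin n → ℝ) (i : Fin n) : ℝ :=
  ∑ j ∈ Finset.univ.erase i, Real.log (w i j)

/-- The column-sums `C j = ∑_{i ≠ j} ln (1 - w_ij)`. -/
noncomputable def colStat {n : ℕ} (w : Fin n → Fin n → ℝ) (j : Fin n) : ℝ :=
  ∑ i ∈ Finset.univ.erase j, Real.log (1 - w i j)

/-- `θ = (a, b)` has positive coordinates and solves the maximum likelihood equations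
with canonical sufficient statistic `(R, C)`. -/
structure IsMLSolution {n : ℕ} (R C : Fin n → ℝ) (θ : Param n) : Prop where
  pos_fst : ∀ i, 0 < θ.1 i
  pos_snd : ∀ j, 0 < θ.2 j
  eq_fst : ∀ i, ∑ j ∈ Finset.univ.erase i, digamma (θ.1 i + θ.2 j)
    - ((n : ℝ) - 1) * digamma (θ.1 i) + R i = 0
  eq_snd : ∀ j, ∑ i ∈ Finset.univ.erase j, digamma (θ.1 i + θ.2 j)
    - ((n : ℝ) - 1) * digamma (θ.2 j) + C j = 0

/-- The iteration map `f = (g, h)`. -/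
noncomputable def iterMap {n : ℕ} (R C : Fin n → ℝ) (θ : Param n) : Param n :=
  (fun i => digammaInv (R i / ((n : ℝ) - 1)
      + (∑ j ∈ Finset.univ.erase i, digamma (θ.1 i + θ.2 j)) / ((n : ℝ) - 1)),
   fun j => digammaInv (C j / ((n : ℝ) - 1)
      + (∑ i ∈ Finset.univ.erase j, digamma (θ.1 i + θ.2 j)) / ((n : ℝ) - 1)))

/-- The number `M`, the maximum of all `-R i / (n - 1)` and `-C i / (n - 1)`. -/
noncomputable def maxStat {n : ℕ} (R C : Fin n → ℝ) : ℝ :=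
  max (⨆ i, -(R i / ((n : ℝ) - 1))) (⨆ i, -(C i / ((n : ℝ) - 1)))

/-- `ε > 0` and `ψ(2ε) - ψ(ε) = M`. -/
def IsStart {n : ℕ} (R C : Fin n → ℝ) (ε : ℝ) : Prop :=
  0 < ε ∧ digamma (2 * ε) - digamma ε = maxStat R C

/-- The iterates `θ⁽ᵏ⁾`, started at `θ⁽⁰⁾ = (ε, …, ε)`. -/
noncomputable def iterate {n : ℕ} (R C : Fin n → ℝ) (ε : ℝ) (k : ℕ) : Param n :=
  (iterMap R C)^[k] (fun _ => ε, fun _ => ε)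

end BetaGraph

namespace BetaGraph

/-! ### The digamma function and the monotonicity of `x * ψ'(x)`. -/

section Digamma

open Set

/-! Solutions of the ML equations are positive fixed points of the order-preserving map `f`.
Everything specific to digamma comes from one fact: `x * ψ'(x)` is strictly decreasing
(`strictAntiOn_mul_shiftedZeta_two`), so for `a < s` the difference `ψ(t s) - ψ(t a)` strictly
decreases in `t`. Thus `f` is strictly subhomogeneous at a solution.

Uniqueness: let `t` be the largest coordinate ratio of two solutions. If `t > 1`, the equation at a
coordinate attaining it is violated (`IsMLSolution.fst_ne_mul`).

Convergence: the smallest coordinate `x` of a solution satisfies `ψ(2x) - ψ(x) ≤ M`, so `ε` exists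
and `ε𝟏` lies below the solution, while `ε𝟏 ≤ f(ε𝟏)`. The iterates therefore increase to a fixed
point. Near the solution, `f(tθ) ≥ (1 - q(1 - t))θ` with a fixed `q < 1`
(`IsMLSolution.eventually_smul_le_iterMap`), which gives the geometric rate.

Existence: start the iteration at any `ε` with `ψ(2ε) - ψ(ε) ≥ M`; it increases, so only a bound is
needed. If `θ ≤ f(θ)`, all likelihood scores are nonnegative; weighting them by `θ` and using `log x
- 1/x ≤ ψ(x) ≤ log x` bounds a sum of entropies (`divergence_le`). That sum is continuous,
homogeneous of degree one and positive off the origin of the closed cone unless `w i j = a i / (a i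
+ b j)` throughout, so it dominates a multiple of the norm. The exceptional weights satisfy a
hexagon identity, which has probability zero. -/

theorem differentiableAt_Gamma_of_pos {x : ℝ} (hx : 0 < x) : DifferentiableAt ℝ Real.Gamma x :=
  Real.differentiableAt_Gamma fun m => by
    have : (0 : ℝ) ≤ m := m.cast_nonneg
    linarith

theorem hasDerivAt_log_Gamma {x : ℝ} (hx : 0 < x) :
    HasDerivAt (Real.log ∘ Real.Gamma) (digamma x) x := by
  have h := (differentiableAt_Gamma_of_pos hx).hasDerivAt.log (Real.Gamma_pos_of_pos hx).ne'
  exact h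

theorem log_Gamma_add_one {x : ℝ} (hx : 0 < x) :
    Real.log (Real.Gamma (x + 1)) = Real.log (Real.Gamma x) + Real.log x := by
  rw [Real.Gamma_add_one hx.ne', Real.log_mul hx.ne' (Real.Gamma_pos_of_pos hx).ne', add_comm]

theorem digamma_add_one {x : ℝ} (hx : 0 < x) : digamma (x + 1) = digamma x + 1 / x := by
  have h1 : HasDerivAt (fun y => Real.log (Real.Gamma (y + 1))) (digamma (x + 1)) x :=
    (hasDerivAt_log_Gamma (by linarith : 0 < x + 1)).comp_add_const x 1
  have h2 : HasDerivAt (fun y => Real.log (Real.Gamma y) + Real.log y) (digamma x + 1 / x) x := by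
    rw [one_div]
    exact (hasDerivAt_log_Gamma hx).add (Real.hasDerivAt_log hx.ne')
  refine h1.unique (h2.congr_of_eventuallyEq ?_)
  filter_upwards [lt_mem_nhds hx] with y hy using log_Gamma_add_one hy

/-- `log Γ` is convex and its chord over `[x, x + 1]` has slope `log x`; compare with the tangent at
the left endpoint. -/
theorem digamma_le_log {x : ℝ} (hx : 0 < x) : digamma x ≤ Real.log x := by
  have h := Real.convexOn_log_Gamma.le_slope_of_hasDerivAt (mem_Ioi.2 hx)
    (mem_Ioi.2 (by linarith : 0 < x + 1)) (by linarith) (hasDerivAt_log_Gamma hx)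
  simpa [slope_def_field, log_Gamma_add_one hx] using h

theorem log_le_digamma_add_one {x : ℝ} (hx : 0 < x) : Real.log x ≤ digamma (x + 1) := by
  have h := Real.convexOn_log_Gamma.slope_le_of_hasDerivAt (mem_Ioi.2 hx)
    (mem_Ioi.2 (by linarith : 0 < x + 1)) (by linarith)
    (hasDerivAt_log_Gamma (by linarith : 0 < x + 1))
  simpa [slope_def_field, log_Gamma_add_one hx] using h

theorem log_sub_inv_le_digamma {x : ℝ} (hx : 0 < x) : Real.log x - 1 / x ≤ digamma x := by
  linarith [log_le_digamma_add_one hx, digamma_add_one hx]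

theorem digamma_sub_digamma_add_nat {x y : ℝ} (hx : 0 < x) (hy : 0 < y) (N : ℕ) :
    ∑ k ∈ Finset.range N, (1 / (x + k) - 1 / (y + k))
      = digamma y - digamma x - (digamma (y + N) - digamma (x + N)) := by
  induction N with
  | zero => simp
  | succ N ih =>
    have h1 := digamma_add_one (by positivity : 0 < x + N)
    have h2 := digamma_add_one (by positivity : 0 < y + N)
    rw [Finset.sum_range_succ, ih]
    push_cast
    rw [← add_assoc, ← add_assoc, h1, h2]
    ring

theorem tendsto_inv_add_nat (x : ℝ) : Tendsto (fun N : ℕ => 1 / (x + N)) atTop (𝓝 0) := by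
  simp only [one_div]
  exact (tendsto_atTop_add_const_left _ _ tendsto_natCast_atTop_atTop).inv_tendsto_atTop

theorem tendsto_log_sub_log_add_nat (x y : ℝ) :
    Tendsto (fun N : ℕ => Real.log (y + N) - Real.log (x + N)) atTop (𝓝 0) := by
  have h1 : Tendsto (fun N : ℕ => (y + N) / (x + N)) atTop (𝓝 1) := by
    have h : Tendsto (fun N : ℕ => 1 + (y - x) * (1 / (x + N))) atTop (𝓝 (1 + (y - x) * 0)) :=
      tendsto_const_nhds.add (tendsto_const_nhds.mul (tendsto_inv_add_nat x))
    rw [mul_zero, add_zero] at h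
    refine h.congr' ?_
    filter_upwards [(tendsto_atTop_add_const_left _ x
      tendsto_natCast_atTop_atTop).eventually_gt_atTop (0 : ℝ)] with N hN
    field_simp
    ring
  have h2 := (Real.continuousAt_log one_ne_zero).tendsto.comp h1
  rw [Real.log_one] at h2
  refine h2.congr' ?_
  filter_upwards [(tendsto_atTop_add_const_left _ x
      tendsto_natCast_atTop_atTop).eventually_gt_atTop (0 : ℝ), (tendsto_atTop_add_const_left _ y
      tendsto_natCast_atTop_atTop).eventually_gt_atTop (0 : ℝ)] with N hN hN'
  simp [Real.log_div hN'.ne' hN.ne']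

theorem tendsto_digamma_sub_digamma_add_nat {x y : ℝ} (hx : 0 < x) (hy : 0 < y) :
    Tendsto (fun N : ℕ => digamma (y + N) - digamma (x + N)) atTop (𝓝 0) := by
  have hl := (tendsto_log_sub_log_add_nat x y).sub (tendsto_inv_add_nat y)
  have hu := (tendsto_log_sub_log_add_nat x y).add (tendsto_inv_add_nat x)
  rw [sub_zero] at hl
  rw [add_zero] at hu
  refine tendsto_of_tendsto_of_tendsto_of_le_of_le hl hu (fun N => ?_) fun N => ?_
  · have h1 := log_sub_inv_le_digamma (by positivity : 0 < y + N)
    have h2 := digamma_le_log (by positivity : 0 < x + N)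
    simp only
    linarith
  · have h1 := log_sub_inv_le_digamma (by positivity : 0 < x + N)
    have h2 := digamma_le_log (by positivity : 0 < y + N)
    simp only
    linarith

theorem hasSum_digamma_sub_of_le {x y : ℝ} (hx : 0 < x) (hxy : x ≤ y) :
    HasSum (fun k : ℕ => 1 / (x + k) - 1 / (y + k)) (digamma y - digamma x) := by
  have hy : 0 < y := hx.trans_le hxy
  refine (hasSum_iff_tendsto_nat_of_nonneg (fun k => ?_) _).2 ?_
  · exact sub_nonneg.2 (one_div_le_one_div_of_le (by positivity) (by linarith))
  · simp only [digamma_sub_digamma_add_nat hx hy]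
    simpa using (tendsto_const_nhds (x := digamma y - digamma x)).sub
      (tendsto_digamma_sub_digamma_add_nat hx hy)

theorem hasSum_digamma_sub {x y : ℝ} (hx : 0 < x) (hy : 0 < y) :
    HasSum (fun k : ℕ => 1 / (x + k) - 1 / (y + k)) (digamma y - digamma x) := by
  rcases le_total x y with h | h
  · exact hasSum_digamma_sub_of_le hx h
  · simpa using (hasSum_digamma_sub_of_le hy h).neg

/-- The series `∑ 1 / (x + k) ^ m`, which for `m ≥ 2` is a multiple of a derivative of digamma. -/
noncomputable def shiftedZeta (m : ℕ) (x : ℝ) : ℝ := ∑' k : ℕ, 1 / (x + k) ^ m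

theorem summable_shiftedZeta {m : ℕ} (hm : 2 ≤ m) {x : ℝ} (hx : 0 < x) :
    Summable fun k : ℕ => 1 / (x + k) ^ m := by
  rw [← summable_nat_add_iff 1]
  refine Summable.of_nonneg_of_le (fun k => by positivity) (fun k => ?_)
    ((summable_nat_add_iff 1).2 (Real.summable_one_div_nat_pow.2 (by lia : 1 < m)))
  exact one_div_le_one_div_of_le (by positivity)
    (pow_le_pow_left₀ (by positivity) (by linarith) _)

theorem shiftedZeta_eq_add {m : ℕ} (hm : 2 ≤ m) {x : ℝ} (hx : 0 < x) :
    shiftedZeta m x = 1 / x ^ m + shiftedZeta m (x + 1) := by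
  rw [shiftedZeta, (summable_shiftedZeta hm hx).tsum_eq_zero_add, shiftedZeta]
  simp [add_assoc, add_comm (1 : ℝ)]

theorem shiftedZeta_pos {m : ℕ} (hm : 2 ≤ m) {x : ℝ} (hx : 0 < x) : 0 < shiftedZeta m x :=
  (summable_shiftedZeta hm hx).tsum_pos (fun k => by positivity) 0 (by positivity)

/-- Compare termwise with the telescoping series for `ψ(x + 1) - ψ(x) = 1 / x`. -/
theorem shiftedZeta_two_add_one_le {x : ℝ} (hx : 0 < x) : shiftedZeta 2 (x + 1) ≤ 1 / x := by
  have h := hasSum_digamma_sub hx (by linarith : 0 < x + 1)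
  rw [digamma_add_one hx, add_sub_cancel_left] at h
  refine hasSum_le (fun k => ?_) (summable_shiftedZeta le_rfl (by linarith : 0 < x + 1)).hasSum h
  have : 0 < x + k := by positivity
  rw [show 1 / (x + k) - 1 / (x + 1 + k) = 1 / ((x + k) * (x + 1 + k)) by field_simp; ring]
  exact one_div_le_one_div_of_le (by positivity) (by nlinarith)

theorem hasDerivAt_shiftedZeta {m : ℕ} (hm : 2 ≤ m) {x : ℝ} (hx : 0 < x) :
    HasDerivAt (shiftedZeta m) (-m * shiftedZeta (m + 1) x) x := by
  have hd : 0 < x / 2 := by linarith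
  -- On `(x / 2, ∞)` the derivatives of the terms are dominated by their values at `x / 2`, up to
  -- sign.
  have h := hasDerivAt_tsum_of_isPreconnected (t := Ioi (x / 2)) (y := x) (y₀ := x)
    (g := fun (k : ℕ) (y : ℝ) => 1 / (y + k) ^ m)
    (g' := fun (k : ℕ) (y : ℝ) => -(m : ℝ) * (1 / (y + k) ^ (m + 1)))
    (u := fun k : ℕ => (m : ℝ) * (1 / (x / 2 + k) ^ (m + 1)))
    ((summable_shiftedZeta (by lia) hd).mul_left _) isOpen_Ioi isPreconnected_Ioi
    (fun k y hy => ?_) (fun k y hy => ?_) (mem_Ioi.2 (by linarith)) (summable_shiftedZeta hm hx)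
    (mem_Ioi.2 (by linarith))
  · rw [tsum_mul_left] at h
    exact h
  · have hy' : 0 < y + k := add_pos_of_pos_of_nonneg (hd.trans hy) k.cast_nonneg
    have h := ((hasDerivAt_zpow (-(m : ℤ)) (y + k) (Or.inl hy'.ne')).comp_add_const y (k : ℝ))
    refine (h.congr_deriv ?_).congr_of_eventuallyEq (Eventually.of_forall fun z => ?_)
    · rw [show -(m : ℤ) - 1 = -((m + 1 : ℕ) : ℤ) by push_cast; ring, zpow_neg, zpow_natCast]
      simp
    · simp [zpow_neg]
  · have hy' : x / 2 < y := hy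
    have hy0 : 0 < y := hd.trans hy
    rw [norm_mul, norm_neg, Real.norm_natCast, Real.norm_of_nonneg (by positivity)]
    gcongr

theorem hasDerivAt_digamma {x : ℝ} (hx : 0 < x) : HasDerivAt digamma (shiftedZeta 2 x) x := by
  have hd : 0 < x / 2 := by linarith
  have h := hasDerivAt_tsum_of_isPreconnected (t := Ioi (x / 2)) (y := x) (y₀ := x)
    (g := fun (k : ℕ) (y : ℝ) => 1 / (x + k) - 1 / (y + k))
    (g' := fun (k : ℕ) (y : ℝ) => 1 / (y + k) ^ 2)
    (u := fun k : ℕ => 1 / (x / 2 + k) ^ 2)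
    (summable_shiftedZeta le_rfl hd) isOpen_Ioi isPreconnected_Ioi
    (fun k y hy => ?_) (fun k y hy => ?_) (mem_Ioi.2 (by linarith))
    (hasSum_digamma_sub hx hx).summable (mem_Ioi.2 (by linarith))
  · refine (h.const_add (digamma x)).congr_of_eventuallyEq ?_
    filter_upwards [lt_mem_nhds hx] with y hy
    rw [(hasSum_digamma_sub hx hy).tsum_eq]
    ring
  · have hy' : 0 < y + k := add_pos_of_pos_of_nonneg (hd.trans hy) k.cast_nonneg
    have h := ((hasDerivAt_inv hy'.ne').comp_add_const y (k : ℝ)).const_sub (1 / (x + k))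
    simpa using h
  · have hy' : x / 2 < y := hy
    have hy0 : 0 < y := hd.trans hy
    rw [Real.norm_of_nonneg (by positivity)]
    gcongr

theorem continuousAt_digamma {x : ℝ} (hx : 0 < x) : ContinuousAt digamma x :=
  (hasDerivAt_digamma hx).continuousAt

theorem continuousAt_shiftedZeta_two {x : ℝ} (hx : 0 < x) : ContinuousAt (shiftedZeta 2) x :=
  (hasDerivAt_shiftedZeta le_rfl hx).continuousAt

theorem continuousOn_digamma : ContinuousOn digamma (Ioi 0) :=
  fun _ hx => (continuousAt_digamma hx).continuousWithinAt

theorem strictMonoOn_digamma : StrictMonoOn digamma (Ioi 0) := by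
  refine strictMonoOn_of_deriv_pos (convex_Ioi 0) continuousOn_digamma fun x hx => ?_
  rw [interior_Ioi] at hx
  rw [(hasDerivAt_digamma hx).deriv]
  exact shiftedZeta_pos le_rfl hx

theorem digamma_le {x y : ℝ} (hx : 0 < x) (hxy : x ≤ y) : digamma x ≤ digamma y :=
  strictMonoOn_digamma.monotoneOn hx (hx.trans_le hxy : (0 : ℝ) < y) hxy

theorem le_of_digamma_le {x y : ℝ} (hx : 0 < x) (hy : 0 < y) (h : digamma x ≤ digamma y) :
    x ≤ y :=
  (strictMonoOn_digamma.le_iff_le hx hy).1 h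

theorem exists_digamma_eq (y : ℝ) : ∃ x ∈ Ioi (0 : ℝ), digamma x = y := by
  have hu : digamma (Real.exp y) ≤ y := by
    simpa using digamma_le_log (Real.exp_pos y)
  have hl : y ≤ digamma (Real.exp y + 1) := by
    simpa using log_le_digamma_add_one (Real.exp_pos y)
  obtain ⟨x, hx, rfl⟩ := intermediate_value_Icc (by linarith : Real.exp y ≤ Real.exp y + 1)
    (continuousOn_digamma.mono fun z hz => (Real.exp_pos y).trans_le hz.1) ⟨hu, hl⟩
  exact ⟨x, (Real.exp_pos _).trans_le hx.1, rfl⟩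

theorem digammaInv_pos (y : ℝ) : 0 < digammaInv y :=
  Function.invFunOn_mem (exists_digamma_eq y)

theorem digamma_digammaInv (y : ℝ) : digamma (digammaInv y) = y :=
  Function.invFunOn_eq (exists_digamma_eq y)

/-- Splitting off the `k = 0` terms, the difference of the two sides is `1 / x ^ 3 - shiftedZeta 2
(x + 1) / (x * (x + 1))`, which is positive since `shiftedZeta 2 (x + 1) ≤ 1 / x < 1 / x + 1 / x ^
2`. -/
theorem shiftedZeta_two_div_lt_succ {x : ℝ} (hx : 0 < x) :
    2 * shiftedZeta 3 (x + 1) - shiftedZeta 2 (x + 1) / (x + 1)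
      < 2 * shiftedZeta 3 x - shiftedZeta 2 x / x := by
  have h1 : shiftedZeta 2 (x + 1) < 1 / x + 1 / x ^ 2 := by
    have := shiftedZeta_two_add_one_le hx
    have : 0 < 1 / x ^ 2 := by positivity
    linarith
  rw [shiftedZeta_eq_add (by norm_num : 2 ≤ 3) hx, shiftedZeta_eq_add (by norm_num : 2 ≤ 2) hx]
  have h2 : shiftedZeta 2 (x + 1) * (1 / (x * (x + 1))) < (1 / x + 1 / x ^ 2) * (1 / (x * (x + 1))) :=
    mul_lt_mul_of_pos_right h1 (by positivity)
  have h3 : (1 / x + 1 / x ^ 2) * (1 / (x * (x + 1))) = 1 / x ^ 3 := by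
    field_simp
  have h4 : shiftedZeta 2 (x + 1) / x - shiftedZeta 2 (x + 1) / (x + 1)
      = shiftedZeta 2 (x + 1) * (1 / (x * (x + 1))) := by
    field_simp
    ring
  have h5 : (1 / x ^ 2 + shiftedZeta 2 (x + 1)) / x = 1 / x ^ 3 + shiftedZeta 2 (x + 1) / x := by
    field_simp
  rw [h5]
  linarith

/-- The function `p` strictly decreases under unit shifts and is bounded below along them by a
sequence tending to `0`, hence is positive. The inequality says that `x * ψ'(x)` has negative
derivative. -/
theorem shiftedZeta_two_lt {x : ℝ} (hx : 0 < x) : shiftedZeta 2 x < 2 * x * shiftedZeta 3 x := by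
  obtain ⟨p, hp⟩ : ∃ p : ℝ → ℝ, ∀ y, p y = 2 * shiftedZeta 3 y - shiftedZeta 2 y / y :=
    ⟨_, fun _ => rfl⟩
  have hanti : Antitone fun n : ℕ => p (x + 1 + n) := by
    refine antitone_nat_of_succ_le fun n => ?_
    have := shiftedZeta_two_div_lt_succ (by positivity : 0 < x + 1 + n)
    push_cast
    rw [← add_assoc, hp, hp]
    exact this.le
  have hlow : ∀ n : ℕ, -(1 / (x + n)) ≤ p (x + 1 + n) := by
    intro n
    have h0 : 0 < x + n := by positivity
    have h3 := shiftedZeta_pos (by norm_num : 2 ≤ 3) (by linarith : 0 < x + n + 1)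
    have h2 := shiftedZeta_two_add_one_le h0
    have h2' : shiftedZeta 2 (x + n + 1) / (x + n + 1) ≤ shiftedZeta 2 (x + n + 1) :=
      div_le_self (shiftedZeta_pos le_rfl (by linarith)).le (by
        have : (0 : ℝ) ≤ n := n.cast_nonneg
        linarith)
    rw [hp, show x + 1 + (n : ℝ) = x + n + 1 by ring]
    linarith
  have h0 : 0 ≤ p (x + 1) := by
    refine le_of_tendsto (f := fun n : ℕ => -(1 / (x + n))) (x := atTop) ?_
      (Eventually.of_forall fun n => (hlow n).trans ?_)
    · simpa using (tendsto_inv_add_nat x).neg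
    · have h := hanti (Nat.zero_le n)
      simpa only [Nat.cast_zero, add_zero] using h
  have h1 : 0 < p x := h0.trans_lt (by rw [hp, hp]; exact shiftedZeta_two_div_lt_succ hx)
  have h2 : 0 < p x * x := mul_pos h1 hx
  have h3 : p x * x = 2 * x * shiftedZeta 3 x - shiftedZeta 2 x := by
    rw [hp]
    field_simp
  linarith

theorem strictAntiOn_mul_shiftedZeta_two :
    StrictAntiOn (fun x => x * shiftedZeta 2 x) (Ioi 0) := by
  have hd : ∀ x : ℝ, 0 < x → HasDerivAt (fun x => x * shiftedZeta 2 x)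
      (1 * shiftedZeta 2 x + x * (-(2 : ℕ) * shiftedZeta 3 x)) x := fun x hx =>
    (hasDerivAt_id x).mul (hasDerivAt_shiftedZeta le_rfl hx)
  refine strictAntiOn_of_deriv_neg (convex_Ioi 0)
    (fun x hx => (hd x hx).continuousAt.continuousWithinAt) fun x hx => ?_
  rw [interior_Ioi] at hx
  rw [(hd x hx).deriv]
  have := shiftedZeta_two_lt hx
  push_cast
  linarith

/-- `t` times the derivative is the difference of `u * ψ'(u)` at `u = t s` and `u = t a`. -/
theorem strictAntiOn_digamma_mul_sub {a s : ℝ} (ha : 0 < a) (has : a < s) :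
    StrictAntiOn (fun t => digamma (t * s) - digamma (t * a)) (Ioi 0) := by
  have hs : 0 < s := ha.trans has
  have hd : ∀ t : ℝ, 0 < t → HasDerivAt (fun t => digamma (t * s) - digamma (t * a))
      (shiftedZeta 2 (t * s) * s - shiftedZeta 2 (t * a) * a) t := fun t ht =>
    ((hasDerivAt_digamma (mul_pos ht hs)).comp t (hasDerivAt_mul_const s)).sub
      ((hasDerivAt_digamma (mul_pos ht ha)).comp t (hasDerivAt_mul_const a))
  refine strictAntiOn_of_deriv_neg (convex_Ioi 0)
    (fun x hx => (hd x hx).continuousAt.continuousWithinAt) fun t ht => ?_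
  rw [interior_Ioi] at ht
  have ht' : 0 < t := ht
  rw [(hd t ht).deriv]
  have h : t * s * shiftedZeta 2 (t * s) < t * a * shiftedZeta 2 (t * a) :=
    strictAntiOn_mul_shiftedZeta_two (mul_pos ht ha) (mul_pos ht hs)
      (mul_lt_mul_of_pos_left has ht)
  have : t * (shiftedZeta 2 (t * s) * s - shiftedZeta 2 (t * a) * a) < 0 := by linarith
  exact neg_of_mul_neg_right this ht'.le

theorem antitoneOn_shiftedZeta_two : AntitoneOn (shiftedZeta 2) (Ioi 0) := by
  intro x hx y hy hxy
  have hx' : 0 < x := hx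
  exact (summable_shiftedZeta le_rfl hy).tsum_le_tsum
    (fun k => by gcongr) (summable_shiftedZeta le_rfl hx)

theorem sub_mul_shiftedZeta_le {x y : ℝ} (hx : 0 < x) (hxy : x ≤ y) :
    (y - x) * shiftedZeta 2 y ≤ digamma y - digamma x ∧
      digamma y - digamma x ≤ (y - x) * shiftedZeta 2 x := by
  rcases hxy.eq_or_lt with rfl | hlt
  · simp
  obtain ⟨z, hz, hz'⟩ := exists_hasDerivAt_eq_slope digamma (shiftedZeta 2) hlt
    (continuousOn_digamma.mono fun z hz => hx.trans_le hz.1)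
    (fun z hz => hasDerivAt_digamma (hx.trans hz.1))
  have hz0 : 0 < z := hx.trans hz.1
  rw [eq_div_iff (sub_pos.2 hlt).ne'] at hz'
  rw [← hz', mul_comm _ (y - x)]
  exact ⟨mul_le_mul_of_nonneg_left
      (antitoneOn_shiftedZeta_two hz0 (hx.trans hlt : (0 : ℝ) < y) hz.2.le) (sub_pos.2 hlt).le,
    mul_le_mul_of_nonneg_left (antitoneOn_shiftedZeta_two hx hz0 hz.1.le) (sub_pos.2 hlt).le⟩

/-- Shrinking the larger argument `s` by the factor `t` changes digamma by no more than shrinking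
the smaller argument `a` by a factor that is closer to `1`, uniformly for `t` near `1`. -/
theorem eventually_digamma_sub_le {a s : ℝ} (ha : 0 < a) (has : a < s) :
    ∀ᶠ q in 𝓝[<] (1 : ℝ), ∀ᶠ t in 𝓝[≤] (1 : ℝ),
      digamma s - digamma (t * s) ≤ digamma a - digamma ((1 - q * (1 - t)) * a) := by
  have hs : 0 < s := ha.trans has
  have hlt : s * shiftedZeta 2 s < a * shiftedZeta 2 a :=
    strictAntiOn_mul_shiftedZeta_two ha hs has
  have h0 : 0 < a * shiftedZeta 2 a := mul_pos ha (shiftedZeta_pos le_rfl ha)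
  -- The gap between `s ψ'(s)` and `a ψ'(a)` leaves room for `q < 1` and for moving the first factor
  -- to `ψ'(t s)` with `t` near `1`.
  obtain ⟨c, hc1, hc2⟩ := exists_between hlt
  have hc0 : 0 < c := (mul_pos hs (shiftedZeta_pos le_rfl hs)).trans hc1
  filter_upwards [Ioo_mem_nhdsLT ((div_lt_one h0).2 hc2)] with q hq'
  have hq : c / (a * shiftedZeta 2 a) ≤ q := hq'.1.le
  have hq1 : q < 1 := hq'.2
  have hqc : c ≤ q * (a * shiftedZeta 2 a) := (div_le_iff₀ h0).1 hq
  have hq0 : 0 < q := (div_pos hc0 h0).trans_le hq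
  have hcont : Tendsto (fun t : ℝ => s * shiftedZeta 2 (t * s)) (𝓝[≤] 1)
      (𝓝 (s * shiftedZeta 2 s)) := by
    have h1 : ContinuousAt (fun t : ℝ => s * shiftedZeta 2 (t * s)) 1 := by
      refine continuousAt_const.mul (ContinuousAt.comp (f := fun t : ℝ => t * s)
        (g := shiftedZeta 2) ?_ (by fun_prop))
      rw [one_mul]
      exact continuousAt_shiftedZeta_two hs
    have h2 : Tendsto _ _ _ := h1
    simp only [one_mul] at h2
    exact h2.mono_left nhdsWithin_le_nhds
  filter_upwards [hcont.eventually_lt_const hc1, self_mem_nhdsWithin,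
    nhdsWithin_le_nhds (lt_mem_nhds (zero_lt_one' ℝ))] with t ht ht1 ht0
  have ht1' : t ≤ 1 := ht1
  have hν : 0 < 1 - q * (1 - t) := by nlinarith
  have hν1 : 1 - q * (1 - t) ≤ 1 := by nlinarith
  have e1 := (sub_mul_shiftedZeta_le (mul_pos ht0 hs) (by nlinarith : t * s ≤ s)).2
  have e2 := (sub_mul_shiftedZeta_le (mul_pos hν ha) (by nlinarith : (1 - q * (1 - t)) * a ≤ a)).1
  have e3 : (1 - t) * (s * shiftedZeta 2 (t * s)) ≤ (1 - t) * (q * (a * shiftedZeta 2 a)) :=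
    mul_le_mul_of_nonneg_left (ht.le.trans hqc) (by linarith)
  have e4 : (s - t * s) * shiftedZeta 2 (t * s) = (1 - t) * (s * shiftedZeta 2 (t * s)) := by ring
  have e5 : (a - (1 - q * (1 - t)) * a) * shiftedZeta 2 a
    = (1 - t) * (q * (a * shiftedZeta 2 a)) := by ring
  linarith

/-- Apply the recurrence at `x` and at `2x`. The bound makes the difference unbounded as `x → 0`. -/
theorem inv_two_mul_le_digamma_two_mul_sub {x : ℝ} (hx : 0 < x) :
    1 / (2 * x) ≤ digamma (2 * x) - digamma x := by
  have h1 := digamma_add_one hx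
  have h2 := digamma_add_one (by linarith : 0 < 2 * x)
  have h3 := digamma_le (by linarith : 0 < x + 1) (by linarith : x + 1 ≤ 2 * x + 1)
  have h4 : 1 / x = 1 / (2 * x) + 1 / (2 * x) := by field_simp; ring
  linarith

theorem strictAntiOn_digamma_two_mul_sub :
    StrictAntiOn (fun x => digamma (2 * x) - digamma x) (Ioi 0) := by
  have h := strictAntiOn_digamma_mul_sub one_pos one_lt_two
  simpa [mul_comm] using h

theorem exists_digamma_two_mul_sub_ge (M : ℝ) :
    ∃ x, 0 < x ∧ M ≤ digamma (2 * x) - digamma x := by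
  have hM : 0 < |M| + 1 := by positivity
  refine ⟨1 / (2 * (|M| + 1)), by positivity, ?_⟩
  have h := inv_two_mul_le_digamma_two_mul_sub (by positivity : 0 < 1 / (2 * (|M| + 1)))
  have h2 : 1 / (2 * (1 / (2 * (|M| + 1)))) = |M| + 1 := by field_simp
  linarith [le_abs_self M]

/-- The difference is always positive, so not every `M` is a value; hence the hypothesis that some
value is at most `M`. -/
theorem exists_digamma_two_mul_sub_eq {M x : ℝ} (hx : 0 < x)
    (h : digamma (2 * x) - digamma x ≤ M) : ∃ y, 0 < y ∧ digamma (2 * y) - digamma y = M := by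
  obtain ⟨z, hz, hzM⟩ := exists_digamma_two_mul_sub_ge M
  have hc : ContinuousOn (fun x => digamma (2 * x) - digamma x) (Ioi 0) := by
    refine ContinuousOn.sub (continuousOn_digamma.comp (by fun_prop) fun y hy => ?_)
      continuousOn_digamma
    exact mul_pos two_pos (mem_Ioi.1 hy)
  obtain ⟨y, hy, hyM⟩ := isPreconnected_Ioi.intermediate_value (mem_Ioi.2 hx) (mem_Ioi.2 hz) hc
    ⟨h, hzM⟩
  exact ⟨y, hy, hyM⟩

end Digamma

end BetaGraph

namespace BetaGraph

/-! ### Uniqueness, monotone iteration and geometric rate. -/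

section Iteration

variable {n : ℕ} {R C : Fin n → ℝ}

theorem natCast_sub_one_pos (hn : 2 ≤ n) : (0 : ℝ) < (n : ℝ) - 1 := by
  have : (2 : ℝ) ≤ n := by exact_mod_cast hn
  linarith

theorem sum_erase_const_sub (i : Fin n) (c : ℝ) (f : Fin n → ℝ) :
    ∑ j ∈ Finset.univ.erase i, (c - f j)
      = ((n : ℝ) - 1) * c - ∑ j ∈ Finset.univ.erase i, f j := by
  have hn : 1 ≤ n := i.pos
  rw [Finset.sum_sub_distrib, Finset.sum_const, Finset.card_erase_of_mem (Finset.mem_univ i),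
    Finset.card_univ, Fintype.card_fin, nsmul_eq_mul, Nat.cast_sub hn, Nat.cast_one]

theorem erase_nonempty (hn : 2 ≤ n) (i : Fin n) : (Finset.univ.erase i).Nonempty := by
  rw [← Finset.card_pos, Finset.card_erase_of_mem (Finset.mem_univ i), Finset.card_univ,
    Fintype.card_fin]
  lia

/-- All coordinates of the parameter vector are positive. -/
structure IsPos (θ : Param n) : Prop where
  fst : ∀ i, 0 < θ.1 i
  snd : ∀ j, 0 < θ.2 j

theorem IsPos.swap {θ : Param n} (h : IsPos θ) : IsPos θ.swap := ⟨h.snd, h.fst⟩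

theorem IsPos.mono {θ θ' : Param n} (h : IsPos θ) (hle : θ ≤ θ') : IsPos θ' :=
  ⟨fun i => (h.fst i).trans_le (hle.1 i), fun i => (h.snd i).trans_le (hle.2 i)⟩

theorem IsPos.smul {θ : Param n} (h : IsPos θ) {t : ℝ} (ht : 0 < t) : IsPos (t • θ) :=
  ⟨fun i => mul_pos ht (h.fst i), fun i => mul_pos ht (h.snd i)⟩

theorem IsMLSolution.isPos {θ : Param n} (h : IsMLSolution R C θ) : IsPos θ :=
  ⟨h.pos_fst, h.pos_snd⟩

theorem IsMLSolution.swap {θ : Param n} (h : IsMLSolution R C θ) : IsMLSolution C R θ.swap where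
  pos_fst := h.pos_snd
  pos_snd := h.pos_fst
  eq_fst i := by simpa [add_comm] using h.eq_snd i
  eq_snd i := by simpa [add_comm] using h.eq_fst i

/-- Exchanging `(a, R)` with `(b, C)` is a symmetry, so later arguments treat only the first half of
the coordinates. -/
theorem iterMap_swap (R C : Fin n → ℝ) (θ : Param n) :
    iterMap C R θ.swap = (iterMap R C θ).swap := by
  simp [iterMap, add_comm]

theorem maxStat_swap (R C : Fin n → ℝ) : maxStat C R = maxStat R C := max_comm _ _

theorem iterMap_isPos (R C : Fin n → ℝ) (θ : Param n) : IsPos (iterMap R C θ) :=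
  ⟨fun _ => digammaInv_pos _, fun _ => digammaInv_pos _⟩

theorem digamma_iterMap_fst (hn : 2 ≤ n) (θ : Param n) (i : Fin n) :
    ∑ j ∈ Finset.univ.erase i, (digamma ((iterMap R C θ).1 i) - digamma (θ.1 i + θ.2 j))
      = R i := by
  have h := natCast_sub_one_pos hn
  rw [sum_erase_const_sub]
  simp only [iterMap, digamma_digammaInv]
  field_simp
  ring

theorem le_iterMap_fst (hn : 2 ≤ n) {θ : Param n} {i : Fin n} {x : ℝ} (hx : 0 < x)
    (h : ∑ j ∈ Finset.univ.erase i, (digamma x - digamma (θ.1 i + θ.2 j)) ≤ R i) :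
    x ≤ (iterMap R C θ).1 i := by
  refine le_of_digamma_le hx ((iterMap_isPos R C θ).fst i) ?_
  rw [← digamma_iterMap_fst (R := R) (C := C) hn θ i, sum_erase_const_sub, sum_erase_const_sub] at h
  exact le_of_mul_le_mul_left (by linarith) (natCast_sub_one_pos hn)

theorem IsMLSolution.sum_eq {θ : Param n} (h : IsMLSolution R C θ) (i : Fin n) :
    ∑ j ∈ Finset.univ.erase i, (digamma (θ.1 i) - digamma (θ.1 i + θ.2 j)) = R i := by
  rw [sum_erase_const_sub]
  linarith [h.eq_fst i]

theorem IsMLSolution.iterMap_eq (hn : 2 ≤ n) {θ : Param n} (h : IsMLSolution R C θ) :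
    iterMap R C θ = θ := by
  have key : ∀ (R C : Fin n → ℝ) (θ : Param n), IsMLSolution R C θ → (iterMap R C θ).1 = θ.1 := by
    intro R C θ h
    funext i
    have h1 := digamma_iterMap_fst (R := R) (C := C) hn θ i
    rw [← h.sum_eq i, sum_erase_const_sub, sum_erase_const_sub] at h1
    exact strictMonoOn_digamma.injOn ((iterMap_isPos R C θ).fst i) (h.pos_fst i)
      (mul_left_cancel₀ (natCast_sub_one_pos hn).ne' (by linarith))
  refine Prod.ext (key R C θ h) ?_
  have h2 := key C R θ.swap h.swap
  rwa [iterMap_swap] at h2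

theorem iterMap_mono (hn : 2 ≤ n) {θ θ' : Param n} (hθ : IsPos θ) (hle : θ ≤ θ') :
    iterMap R C θ ≤ iterMap R C θ' := by
  have key : ∀ (R C : Fin n → ℝ) (θ θ' : Param n), IsPos θ → θ ≤ θ' →
      (iterMap R C θ).1 ≤ (iterMap R C θ').1 := by
    intro R C θ θ' hθ hle i
    refine le_iterMap_fst hn ((iterMap_isPos R C θ).fst i) ?_
    rw [← digamma_iterMap_fst (R := R) (C := C) hn θ i]
    refine Finset.sum_le_sum fun j _ => ?_
    have := digamma_le (add_pos (hθ.fst i) (hθ.snd j)) (add_le_add (hle.1 i) (hle.2 j))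
    linarith
  refine ⟨key R C θ θ' hθ hle, ?_⟩
  have h2 := key C R θ.swap θ'.swap hθ.swap ⟨hle.2, hle.1⟩
  rwa [iterMap_swap, iterMap_swap] at h2

/-- At equality, each `ψ(a'ᵢ) - ψ(a'ᵢ + b'ⱼ)` is at least `ψ(t aᵢ) - ψ(t (aᵢ + bⱼ))`, which exceeds
`ψ(aᵢ) - ψ(aᵢ + bⱼ)`; but both sums over `j` equal `R i`. -/
theorem IsMLSolution.fst_ne_mul (hn : 2 ≤ n) {θ θ' : Param n} (h : IsMLSolution R C θ)
    (h' : IsMLSolution R C θ') {t : ℝ} (ht : 1 < t) (hle : θ' ≤ t • θ) (i : Fin n) :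
    θ'.1 i ≠ t * θ.1 i := by
  intro heq
  have ht0 : 0 < t := one_pos.trans ht
  have h1 := h.sum_eq i
  rw [← h'.sum_eq i] at h1
  refine h1.not_lt (Finset.sum_lt_sum_of_nonempty (erase_nonempty hn i) fun j _ => ?_)
  have e1 := strictAntiOn_digamma_mul_sub (h.pos_fst i)
    (by linarith [h.pos_snd j] : θ.1 i < θ.1 i + θ.2 j) (Set.mem_Ioi.2 one_pos)
    (Set.mem_Ioi.2 ht0) ht
  have hj : θ'.2 j ≤ t * θ.2 j := hle.2 j
  have e2 := digamma_le (add_pos (h'.pos_fst i) (h'.pos_snd j))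
    (by rw [heq, mul_add]; linarith : θ'.1 i + θ'.2 j ≤ t * (θ.1 i + θ.2 j))
  simp only [one_mul] at e1
  rw [heq] at e2 ⊢
  linarith

theorem IsMLSolution.le (hn : 2 ≤ n) {θ θ' : Param n} (h : IsMLSolution R C θ)
    (h' : IsMLSolution R C θ') : θ' ≤ θ := by
  set r : Fin n ⊕ Fin n → ℝ := Sum.elim (fun i => θ'.1 i / θ.1 i) (fun j => θ'.2 j / θ.2 j) with hr
  obtain ⟨m, -, hm⟩ := Finset.exists_max_image (Finset.univ : Finset (Fin n ⊕ Fin n)) r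
    ⟨Sum.inl ⟨0, by lia⟩, Finset.mem_univ _⟩
  have hle : θ' ≤ r m • θ :=
    ⟨fun i => (div_le_iff₀ (h.pos_fst i)).1 (hm (Sum.inl i) (Finset.mem_univ _)),
      fun i => (div_le_iff₀ (h.pos_snd i)).1 (hm (Sum.inr i) (Finset.mem_univ _))⟩
  have hr1 : r m ≤ 1 := by
    by_contra! hlt
    rcases m with i | i
    · exact h.fst_ne_mul hn h' hlt hle i (by simp [hr, (h.pos_fst i).ne'])
    · exact h.swap.fst_ne_mul hn h'.swap hlt ⟨hle.2, hle.1⟩ i (by simp [hr, (h.pos_snd i).ne'])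
  exact ⟨fun i => (hle.1 i).trans (mul_le_of_le_one_left (h.pos_fst i).le hr1),
    fun i => (hle.2 i).trans (mul_le_of_le_one_left (h.pos_snd i).le hr1)⟩

theorem IsMLSolution.unique (hn : 2 ≤ n) {θ θ' : Param n} (h : IsMLSolution R C θ)
    (h' : IsMLSolution R C θ') : θ' = θ :=
  le_antisymm (h.le hn h') (h'.le hn h)

theorem le_maxStat_fst (R C : Fin n → ℝ) (i : Fin n) : -(R i / ((n : ℝ) - 1)) ≤ maxStat R C :=
  (le_ciSup (f := fun i => -(R i / ((n : ℝ) - 1))) (Set.finite_range _).bddAbove i).trans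
    (le_max_left _ _)

/-- Every argument `aᵢ + bⱼ` in the `i`-th equation is at least `2x`; average over `j`. -/
theorem IsMLSolution.digamma_two_mul_sub_le (hn : 2 ≤ n) {θ : Param n} (h : IsMLSolution R C θ)
    {x : ℝ} (hx : ∀ j, x ≤ θ.2 j) (i : Fin n) (hi : θ.1 i = x) :
    digamma (2 * x) - digamma x ≤ maxStat R C := by
  subst hi
  refine le_trans ?_ (le_maxStat_fst R C i)
  have hN := natCast_sub_one_pos hn
  rw [← neg_div, le_div_iff₀ hN, ← h.sum_eq i, ← Finset.sum_neg_distrib]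
  have h1 : ∑ j ∈ Finset.univ.erase i, (digamma (2 * θ.1 i) - digamma (θ.1 i))
      = (digamma (2 * θ.1 i) - digamma (θ.1 i)) * ((n : ℝ) - 1) := by
    rw [sum_erase_const_sub i _ (fun _ => digamma (θ.1 i))]
    have h3 := sum_erase_const_sub i (digamma (θ.1 i)) (fun _ => digamma (θ.1 i))
    simp only [sub_self, Finset.sum_const_zero] at h3
    linarith
  rw [← h1]
  refine Finset.sum_le_sum fun j _ => ?_
  have := digamma_le (by linarith [h.pos_fst i] : 0 < 2 * θ.1 i)
    (by linarith [hx j] : 2 * θ.1 i ≤ θ.1 i + θ.2 j)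
  linarith

/-- The vector all of whose coordinates are `x`. -/
def constParam (n : ℕ) (x : ℝ) : Param n := (fun _ => x, fun _ => x)

theorem constParam_isPos {x : ℝ} (hx : 0 < x) : IsPos (constParam n x) :=
  ⟨fun _ => hx, fun _ => hx⟩

theorem IsMLSolution.exists_const_le (hn : 2 ≤ n) {θ : Param n} (h : IsMLSolution R C θ) :
    ∃ x, 0 < x ∧ constParam n x ≤ θ ∧ digamma (2 * x) - digamma x ≤ maxStat R C := by
  obtain ⟨m, -, hm⟩ := Finset.exists_min_image (Finset.univ : Finset (Fin n ⊕ Fin n))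
    (Sum.elim θ.1 θ.2) ⟨Sum.inl ⟨0, by lia⟩, Finset.mem_univ _⟩
  have h1 : ∀ i, Sum.elim θ.1 θ.2 m ≤ θ.1 i := fun i => hm (Sum.inl i) (Finset.mem_univ _)
  have h2 : ∀ i, Sum.elim θ.1 θ.2 m ≤ θ.2 i := fun i => hm (Sum.inr i) (Finset.mem_univ _)
  refine ⟨Sum.elim θ.1 θ.2 m, ?_, ⟨h1, h2⟩, ?_⟩
  · rcases m with i | i
    exacts [h.pos_fst i, h.pos_snd i]
  · rcases m with i | i
    · exact h.digamma_two_mul_sub_le hn h2 i rfl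
    · rw [← maxStat_swap]
      exact h.swap.digamma_two_mul_sub_le hn h1 i rfl

theorem IsMLSolution.existsUnique_isStart (hn : 2 ≤ n) {θ : Param n} (h : IsMLSolution R C θ) :
    ∃! ε, IsStart R C ε := by
  obtain ⟨x, hx, -, hxM⟩ := h.exists_const_le hn
  obtain ⟨y, hy, hyM⟩ := exists_digamma_two_mul_sub_eq hx hxM
  exact ⟨y, ⟨hy, hyM⟩, fun z hz => strictAntiOn_digamma_two_mul_sub.injOn hz.1 hy
    (hz.2.trans hyM.symm)⟩

theorem IsMLSolution.constParam_le (hn : 2 ≤ n) {θ : Param n} (h : IsMLSolution R C θ) {ε : ℝ}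
    (hε : IsStart R C ε) : constParam n ε ≤ θ := by
  obtain ⟨x, hx, hxθ, hxM⟩ := h.exists_const_le hn
  have : ε ≤ x := (strictAntiOn_digamma_two_mul_sub.le_iff_ge hx hε.1).1 (hxM.trans hε.2.ge)
  exact le_trans (b := constParam n x) ⟨fun _ => this, fun _ => this⟩ hxθ

/-- An inequality suffices here, so the existence proof can use it before `M` is known to be a value
of the difference. -/
theorem constParam_le_iterMap (hn : 2 ≤ n) {ε : ℝ} (hε : 0 < ε)
    (h : maxStat R C ≤ digamma (2 * ε) - digamma ε) :
    constParam n ε ≤ iterMap R C (constParam n ε) := by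
  have key : ∀ R C : Fin n → ℝ, maxStat R C ≤ digamma (2 * ε) - digamma ε →
      (constParam n ε).1 ≤ (iterMap R C (constParam n ε)).1 := by
    intro R C h i
    refine le_iterMap_fst hn hε ?_
    have h1 := (le_maxStat_fst R C i).trans h
    rw [← neg_div, div_le_iff₀ (natCast_sub_one_pos hn)] at h1
    have h2 := sum_erase_const_sub i (digamma ε - digamma (ε + ε)) (fun _ => 0)
    simp only [sub_zero, Finset.sum_const_zero] at h2
    simp only [constParam]
    rw [h2, ← two_mul]
    linarith
  exact ⟨key R C h, key C R (by rwa [maxStat_swap])⟩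

theorem iterate_succ (R C : Fin n → ℝ) (ε : ℝ) (k : ℕ) :
    iterate R C ε (k + 1) = iterMap R C (iterate R C ε k) :=
  Function.iterate_succ_apply' _ _ _

theorem iterate_isPos {ε : ℝ} (hε : 0 < ε) (k : ℕ) : IsPos (iterate R C ε k) := by
  cases k with
  | zero => exact constParam_isPos hε
  | succ k => rw [iterate_succ]; exact iterMap_isPos _ _ _

theorem iterate_le_succ (hn : 2 ≤ n) {ε : ℝ} (hε : 0 < ε)
    (h : maxStat R C ≤ digamma (2 * ε) - digamma ε) (k : ℕ) :
    iterate R C ε k ≤ iterate R C ε (k + 1) := by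
  induction k with
  | zero => rw [iterate_succ]; exact constParam_le_iterMap hn hε h
  | succ k ih =>
    rw [iterate_succ R C ε (k + 1)]
    conv_lhs => rw [iterate_succ]
    exact iterMap_mono hn (iterate_isPos hε k) ih

theorem iterate_monotone (hn : 2 ≤ n) {ε : ℝ} (hε : 0 < ε)
    (h : maxStat R C ≤ digamma (2 * ε) - digamma ε) : Monotone (iterate R C ε) :=
  monotone_nat_of_le_succ (iterate_le_succ hn hε h)

theorem IsMLSolution.iterate_le (hn : 2 ≤ n) {θ : Param n} (h : IsMLSolution R C θ) {ε : ℝ}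
    (hε : IsStart R C ε) (k : ℕ) : iterate R C ε k ≤ θ := by
  induction k with
  | zero => exact h.constParam_le hn hε
  | succ k ih =>
    rw [iterate_succ, ← h.iterMap_eq hn]
    exact iterMap_mono hn (iterate_isPos hε.1 k) ih

theorem tendsto_digamma_sum (hn : 2 ≤ n) {u : ℕ → Param n} {L : Param n} (hL : IsPos L)
    (hu : Tendsto u atTop (𝓝 L)) (hs : ∀ k, u (k + 1) = iterMap R C (u k)) :
    ∀ i, ∑ j ∈ Finset.univ.erase i, digamma (L.1 i + L.2 j)
    - ((n : ℝ) - 1) * digamma (L.1 i) + R i = 0 := by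
  intro i
  have h1 : ∀ i, Tendsto (fun k => (u k).1 i) atTop (𝓝 (L.1 i)) := fun i =>
    ((continuous_apply i).comp continuous_fst).continuousAt.tendsto.comp hu
  have h2 : ∀ i, Tendsto (fun k => (u k).2 i) atTop (𝓝 (L.2 i)) := fun i =>
    ((continuous_apply i).comp continuous_snd).continuousAt.tendsto.comp hu
  have h3 : Tendsto (fun k => ∑ j ∈ Finset.univ.erase i,
      (digamma ((u (k + 1)).1 i) - digamma ((u k).1 i + (u k).2 j))) atTop
      (𝓝 (∑ j ∈ Finset.univ.erase i, (digamma (L.1 i) - digamma (L.1 i + L.2 j)))) := by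
    refine tendsto_finsetSum _ fun j _ => Tendsto.sub ?_ ?_
    · exact (continuousAt_digamma (hL.fst i)).tendsto.comp ((h1 i).comp (tendsto_add_atTop_nat 1))
    · exact (continuousAt_digamma (add_pos (hL.fst i) (hL.snd j))).tendsto.comp
        ((h1 i).add (h2 j))
  simp only [hs, digamma_iterMap_fst hn] at h3
  have h4 := tendsto_nhds_unique h3 tendsto_const_nhds
  rw [sum_erase_const_sub] at h4
  linarith

/-- The bound `B` need not be a solution: existence takes it from the entropy estimate, convergence
takes the given solution. -/
theorem exists_tendsto_iterate (hn : 2 ≤ n) {ε : ℝ} (hε : 0 < ε)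
    (hmono : Monotone (iterate R C ε)) {B : Param n} (hB : ∀ k, iterate R C ε k ≤ B) :
    ∃ L, IsMLSolution R C L ∧ Tendsto (iterate R C ε) atTop (𝓝 L) := by
  set u := iterate R C ε
  have h1 : ∀ i, Tendsto (fun k => (u k).1 i) atTop (𝓝 (⨆ k, (u k).1 i)) := fun i =>
    tendsto_atTop_ciSup (fun k l hkl => (hmono hkl).1 i)
      ⟨B.1 i, by rintro _ ⟨k, rfl⟩; exact (hB k).1 i⟩
  have h2 : ∀ i, Tendsto (fun k => (u k).2 i) atTop (𝓝 (⨆ k, (u k).2 i)) := fun i =>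
    tendsto_atTop_ciSup (fun k l hkl => (hmono hkl).2 i)
      ⟨B.2 i, by rintro _ ⟨k, rfl⟩; exact (hB k).2 i⟩
  set L : Param n := (fun i => ⨆ k, (u k).1 i, fun i => ⨆ k, (u k).2 i)
  have hu : Tendsto u atTop (𝓝 L) :=
    Tendsto.prodMk_nhds (tendsto_pi_nhds.2 h1) (tendsto_pi_nhds.2 h2)
  have hL : IsPos L := (iterate_isPos hε 0).mono (ge_of_tendsto hu
    (Eventually.of_forall fun k => hmono (Nat.zero_le k)))
  refine ⟨L, ⟨hL.fst, hL.snd, tendsto_digamma_sum hn hL hu (iterate_succ R C ε), ?_⟩, hu⟩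
  have h3 := tendsto_digamma_sum (R := C) (C := R) (u := fun k => (u k).swap) hn hL.swap
    ((continuous_swap.tendsto L).comp hu) fun k => by rw [iterMap_swap, ← iterate_succ R C ε k]
  intro j
  simpa [add_comm] using h3 j

theorem IsMLSolution.eventually_smul_le_iterMap (hn : 2 ≤ n) {θ : Param n}
    (h : IsMLSolution R C θ) : ∀ᶠ q in 𝓝[<] (1 : ℝ), ∀ᶠ t in 𝓝[≤] (1 : ℝ),
      (1 - q * (1 - t)) • θ ≤ iterMap R C (t • θ) := by
  have key : ∀ (R C : Fin n → ℝ) (θ : Param n), IsMLSolution R C θ →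
      ∀ᶠ q in 𝓝[<] (1 : ℝ), ∀ᶠ t in 𝓝[≤] (1 : ℝ),
        ∀ i, (1 - q * (1 - t)) * θ.1 i ≤ (iterMap R C (t • θ)).1 i := by
    intro R C θ h
    have h1 : ∀ᶠ q in 𝓝[<] (1 : ℝ), ∀ i j, ∀ᶠ t in 𝓝[≤] (1 : ℝ),
        digamma (θ.1 i + θ.2 j) - digamma (t * (θ.1 i + θ.2 j))
          ≤ digamma (θ.1 i) - digamma ((1 - q * (1 - t)) * θ.1 i) :=
      eventually_all.2 fun i => eventually_all.2 fun j =>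
        eventually_digamma_sub_le (h.pos_fst i) (by linarith [h.pos_snd j])
    filter_upwards [h1, Ioo_mem_nhdsLT (zero_lt_one' ℝ)] with q hq hq01
    have h2 : ∀ᶠ t in 𝓝[≤] (1 : ℝ), ∀ i j,
        digamma (θ.1 i + θ.2 j) - digamma (t * (θ.1 i + θ.2 j))
          ≤ digamma (θ.1 i) - digamma ((1 - q * (1 - t)) * θ.1 i) :=
      eventually_all.2 fun i => eventually_all.2 fun j => hq i j
    filter_upwards [h2, Ioc_mem_nhdsLE (zero_lt_one' ℝ)] with t ht ht01 i
    have hν : 0 < 1 - q * (1 - t) := by nlinarith [hq01.1, hq01.2, ht01.1, ht01.2]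
    refine le_iterMap_fst hn (mul_pos hν (h.pos_fst i)) ?_
    rw [← h.sum_eq i]
    refine Finset.sum_le_sum fun j _ => ?_
    have e := ht i j
    rw [mul_add] at e
    simp only [Prod.smul_fst, Prod.smul_snd, Pi.smul_apply, smul_eq_mul]
    linarith
  filter_upwards [key R C θ h, key C R θ.swap h.swap] with q hq hq'
  filter_upwards [hq, hq'] with t ht ht'
  refine ⟨ht, ?_⟩
  rw [← Prod.smul_swap, iterMap_swap] at ht'
  exact ht'

theorem norm_sub_le_mul_norm {θ x : Param n} {c : ℝ} (hc : 0 ≤ c) (hle : x ≤ θ)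
    (h : (1 - c) • θ ≤ x) : ‖x - θ‖ ≤ c * ‖θ‖ := by
  have key : ∀ u v : Fin n → ℝ, u ≤ v → (1 - c) • v ≤ u → ‖u - v‖ ≤ c * ‖v‖ := by
    intro u v huv hvu
    refine (pi_norm_le_iff_of_nonneg (by positivity)).2 fun i => ?_
    have h1 := huv i
    have h2 : (1 - c) * v i ≤ u i := hvu i
    have h3 : v i ≤ ‖v‖ := (Real.le_norm_self _).trans (norm_le_pi_norm v i)
    have h4 := mul_le_mul_of_nonneg_left h3 hc
    rw [Pi.sub_apply, Real.norm_eq_abs, abs_sub_comm, abs_of_nonneg (by linarith)]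
    linarith
  refine max_le ((key _ _ hle.1 h.1).trans ?_) ((key _ _ hle.2 h.2).trans ?_)
  · exact mul_le_mul_of_nonneg_left (norm_fst_le θ) hc
  · exact mul_le_mul_of_nonneg_left (norm_snd_le θ) hc

theorem IsMLSolution.exists_geometric (hn : 2 ≤ n) {θ : Param n} (h : IsMLSolution R C θ) {ε : ℝ}
    (hε : IsStart R C ε) (hlim : Tendsto (iterate R C ε) atTop (𝓝 θ)) :
    ∃ K q : ℝ, 0 < q ∧ q < 1 ∧ ∀ k, ‖iterate R C ε k - θ‖ ≤ K * q ^ k := by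
  obtain ⟨q, hq, hq0, hq1⟩ := ((h.eventually_smul_le_iterMap hn).and
    (Ioo_mem_nhdsLT (zero_lt_one' ℝ))).exists
  -- The contraction inequality holds on `(t₀, 1]`; any `t` in `(max t₀ 0, 1)` serves as entry
  -- level, since later levels only move up towards `1`.
  obtain ⟨t₀, ht₀, hsub⟩ := (mem_nhdsLE_iff_exists_Ioc_subset' (zero_lt_one' ℝ)).1 hq
  obtain ⟨t, ht, ht1⟩ := exists_between (max_lt ht₀ (zero_lt_one' ℝ))
  have ht0 : 0 < t := (le_max_right _ _).trans_lt ht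
  obtain ⟨k₀, hk₀⟩ : ∃ k, t • θ ≤ iterate R C ε k := by
    have h1 : ∀ i, ∀ᶠ k in atTop, t * θ.1 i < (iterate R C ε k).1 i := fun i =>
      (((continuous_apply i).comp continuous_fst).continuousAt.tendsto.comp hlim).eventually_const_lt
        (mul_lt_of_lt_one_left (h.pos_fst i) ht1)
    have h2 : ∀ i, ∀ᶠ k in atTop, t * θ.2 i < (iterate R C ε k).2 i := fun i =>
      (((continuous_apply i).comp continuous_snd).continuousAt.tendsto.comp hlim).eventually_const_lt
        (mul_lt_of_lt_one_left (h.pos_snd i) ht1)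
    obtain ⟨k, hk, hk'⟩ := ((eventually_all.2 h1).and (eventually_all.2 h2)).exists
    exact ⟨k, fun i => (hk i).le, fun i => (hk' i).le⟩
  have hstep : ∀ j, (1 - q ^ j * (1 - t)) • θ ≤ iterate R C ε (k₀ + j) := by
    intro j
    induction j with
    | zero => simpa using hk₀
    | succ j ih =>
      have hp0 : 0 < q ^ j := pow_pos hq0 j
      have hp1 : q ^ j ≤ 1 := pow_le_one₀ hq0.le hq1.le
      have hs : t ≤ 1 - q ^ j * (1 - t) := by nlinarith
      have hs1 : 1 - q ^ j * (1 - t) ≤ 1 := by nlinarith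
      have e := hsub ⟨((le_max_left _ _).trans_lt ht).trans_le hs, hs1⟩
      have e' : (1 - q * (1 - (1 - q ^ j * (1 - t)))) • θ
        ≤ iterMap R C ((1 - q ^ j * (1 - t)) • θ) := e
      rw [show 1 - q * (1 - (1 - q ^ j * (1 - t))) = 1 - q ^ (j + 1) * (1 - t) by ring] at e'
      rw [← add_assoc, iterate_succ]
      exact e'.trans (iterMap_mono hn (h.isPos.smul (ht0.trans_le hs)) ih)
  -- Dividing by `q ^ k₀` absorbs the first `k₀` steps, where only `0 ≤ θ⁽ᵏ⁾ ≤ θ` is used.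
  refine ⟨‖θ‖ / q ^ k₀, q, hq0, hq1, fun k => ?_⟩
  have hle := h.iterate_le hn hε
  have hqk : 0 < q ^ k₀ := pow_pos hq0 k₀
  rcases le_total k₀ k with hk | hk
  · obtain ⟨j, rfl⟩ := Nat.exists_eq_add_of_le hk
    have hp0 : 0 < q ^ j := pow_pos hq0 j
    refine (norm_sub_le_mul_norm (mul_nonneg hp0.le (sub_nonneg.2 ht1.le)) (hle _)
      (hstep j)).trans ?_
    rw [pow_add, div_mul_eq_mul_div, mul_left_comm, mul_div_cancel_left₀ _ hqk.ne', mul_comm ‖θ‖]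
    exact mul_le_mul_of_nonneg_right (mul_le_of_le_one_right hp0.le (by linarith)) (norm_nonneg _)
  · have h0 : (1 - 1 : ℝ) • θ ≤ iterate R C ε k := by
      rw [sub_self, zero_smul]
      exact ⟨fun i => ((iterate_isPos hε.1 k).fst i).le, fun i => ((iterate_isPos hε.1 k).snd i).le⟩
    refine (norm_sub_le_mul_norm zero_le_one (hle k) h0).trans ?_
    rw [one_mul, div_mul_eq_mul_div, le_div_iff₀ hqk]
    exact mul_le_mul_of_nonneg_left (pow_le_pow_of_le_one hq0.le hq1.le hk) (norm_nonneg _)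

end Iteration

end BetaGraph

namespace BetaGraph

/-! ### Existence of a solution from an entropy bound. -/

section Existence

/-- `(a + b)` times the relative entropy of the Bernoulli distribution with success probability
`a / (a + b)` with respect to the one with success probability `w`. -/
noncomputable def edgeDivergence (w a b : ℝ) : ℝ :=
  a * Real.log a + b * Real.log b - (a + b) * Real.log (a + b) - a * Real.log w
    - b * Real.log (1 - w)

/-- This is `log u ≤ u - 1` at `u = s w / a`, multiplied by `a`. With `s = a + b`, adding the
versions for `(a, w)` and `(b, 1 - w)` cancels the left sides. -/
theorem sub_mul_le_mul_log {a s w : ℝ} (ha : 0 ≤ a) (hs : 0 < s) (hw : 0 < w) :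
    a - s * w ≤ a * Real.log a - a * Real.log s - a * Real.log w := by
  rcases ha.eq_or_lt with rfl | ha
  · simpa using (mul_pos hs hw).le
  have h := Real.log_le_sub_one_of_pos (by positivity : 0 < s * w / a)
  rw [Real.log_div (by positivity) ha.ne', Real.log_mul hs.ne' hw.ne'] at h
  have h2 := mul_le_mul_of_nonneg_left h ha.le
  have h3 : a * (s * w / a - 1) = s * w - a := by field_simp
  linarith

theorem sub_mul_lt_mul_log {a s w : ℝ} (ha : 0 ≤ a) (hs : 0 < s) (hw : 0 < w) (h : a ≠ s * w) :
    a - s * w < a * Real.log a - a * Real.log s - a * Real.log w := by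
  rcases ha.eq_or_lt with rfl | ha
  · simpa using mul_pos hs hw
  have h := Real.log_lt_sub_one_of_pos (by positivity : 0 < s * w / a)
    (fun he => h ((div_eq_one_iff_eq ha.ne').1 he).symm)
  rw [Real.log_div (by positivity) ha.ne', Real.log_mul hs.ne' hw.ne'] at h
  have h2 := mul_lt_mul_of_pos_left h ha
  have h3 : a * (s * w / a - 1) = s * w - a := by field_simp
  linarith

theorem edgeDivergence_eq (w a b : ℝ) : edgeDivergence w a b
    = (a * Real.log a - a * Real.log (a + b) - a * Real.log w)
      + (b * Real.log b - b * Real.log (a + b) - b * Real.log (1 - w)) := by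
  rw [edgeDivergence]
  ring

theorem edgeDivergence_nonneg {w a b : ℝ} (hw : 0 < w) (hw1 : w < 1) (ha : 0 ≤ a) (hb : 0 ≤ b) :
    0 ≤ edgeDivergence w a b := by
  rcases (add_nonneg ha hb).eq_or_lt with hs | hs
  · obtain rfl : a = 0 := by linarith
    obtain rfl : b = 0 := by linarith
    simp [edgeDivergence]
  · rw [edgeDivergence_eq]
    have h1 := sub_mul_le_mul_log ha hs hw
    have h2 := sub_mul_le_mul_log hb hs (sub_pos.2 hw1)
    linarith

theorem mul_one_sub_eq_of_edgeDivergence_eq_zero {w a b : ℝ} (hw : 0 < w) (hw1 : w < 1)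
    (ha : 0 ≤ a) (hb : 0 ≤ b) (h : edgeDivergence w a b = 0) : a * (1 - w) = b * w := by
  rcases (add_nonneg ha hb).eq_or_lt with hs | hs
  · obtain rfl : a = 0 := by linarith
    obtain rfl : b = 0 := by linarith
    simp
  · by_contra hne
    rw [edgeDivergence_eq] at h
    have h1 := sub_mul_lt_mul_log ha hs hw fun he => hne (by linarith)
    have h2 := sub_mul_le_mul_log hb hs (sub_pos.2 hw1)
    linarith

theorem mul_mul_log_mul {t : ℝ} (ht : t ≠ 0) (a : ℝ) :
    t * a * Real.log (t * a) = t * (a * Real.log t) + t * (a * Real.log a) := by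
  rcases eq_or_ne a 0 with rfl | ha
  · simp
  · rw [Real.log_mul ht ha]
    ring

theorem edgeDivergence_mul {t : ℝ} (ht : t ≠ 0) (w a b : ℝ) :
    edgeDivergence w (t * a) (t * b) = t * edgeDivergence w a b := by
  simp only [edgeDivergence]
  rw [← mul_add, mul_mul_log_mul ht, mul_mul_log_mul ht, mul_mul_log_mul ht]
  ring

theorem continuous_edgeDivergence (w : ℝ) :
    Continuous fun p : ℝ × ℝ => edgeDivergence w p.1 p.2 := by
  have h1 := Real.continuous_mul_log.comp (continuous_fst (X := ℝ) (Y := ℝ))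
  have h2 := Real.continuous_mul_log.comp (continuous_snd (X := ℝ) (Y := ℝ))
  have h3 := Real.continuous_mul_log.comp
    ((continuous_fst (X := ℝ) (Y := ℝ)).add (continuous_snd (X := ℝ) (Y := ℝ)))
  exact (((h1.add h2).sub h3).sub (continuous_fst.mul continuous_const)).sub
    (continuous_snd.mul continuous_const)

/-- Replacing `ψ` by `log` costs `x * (1 / x) = 1` for each of `a` and `b`, whence the `2`. -/
theorem edge_score_le {w a b : ℝ} (ha : 0 < a) (hb : 0 < b) :
    a * (digamma (a + b) - digamma a + Real.log w)
      + b * (digamma (a + b) - digamma b + Real.log (1 - w)) ≤ 2 - edgeDivergence w a b := by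
  have hs : 0 < a + b := add_pos ha hb
  have h1 := mul_le_mul_of_nonneg_left (digamma_le_log hs) hs.le
  have h2 := mul_le_mul_of_nonneg_left (log_sub_inv_le_digamma ha) ha.le
  have h3 := mul_le_mul_of_nonneg_left (log_sub_inv_le_digamma hb) hb.le
  rw [mul_sub, mul_one_div_cancel ha.ne'] at h2
  rw [mul_sub, mul_one_div_cancel hb.ne'] at h3
  rw [edgeDivergence]
  linarith

variable {n : ℕ}

/-- The sum of the divergences of all edges. -/
noncomputable def divergence (w : Fin n → Fin n → ℝ) (θ : Param n) : ℝ :=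
  ∑ i, ∑ j ∈ Finset.univ.erase i, edgeDivergence (w i j) (θ.1 i) (θ.2 j)

theorem continuous_divergence (w : Fin n → Fin n → ℝ) : Continuous (divergence w) :=
  continuous_finsetSum _ fun i _ => continuous_finsetSum _ fun j _ =>
    (continuous_edgeDivergence (w i j)).comp
      (by fun_prop : Continuous fun θ : Param n => (θ.1 i, θ.2 j))

theorem divergence_smul {t : ℝ} (ht : t ≠ 0) (w : Fin n → Fin n → ℝ) (θ : Param n) :
    divergence w (t • θ) = t * divergence w θ := by
  simp only [divergence, Prod.smul_fst, Prod.smul_snd, Pi.smul_apply, smul_eq_mul,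
    edgeDivergence_mul ht, Finset.mul_sum]

theorem sum_erase_comm (f : Fin n → Fin n → ℝ) :
    ∑ j, ∑ i ∈ Finset.univ.erase j, f i j = ∑ i, ∑ j ∈ Finset.univ.erase i, f i j :=
  Finset.sum_comm' fun x y => by simp [eq_comm]

theorem sum_erase_le_of_le_iterMap (hn : 2 ≤ n) {R C : Fin n → ℝ} {θ : Param n} (hθ : IsPos θ)
    (h : θ ≤ iterMap R C θ) (i : Fin n) :
    ∑ j ∈ Finset.univ.erase i, (digamma (θ.1 i) - digamma (θ.1 i + θ.2 j)) ≤ R i := by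
  rw [← digamma_iterMap_fst (R := R) (C := C) hn θ i]
  exact Finset.sum_le_sum fun j _ => sub_le_sub_right (digamma_le (hθ.fst i) (h.1 i)) _

/-- By monotonicity of `ψ`, `θ ≤ f(θ)` makes every score nonnegative; sum the scores weighted by `θ`
and apply `edge_score_le` on each edge. -/
theorem divergence_le (hn : 2 ≤ n) {w : Fin n → Fin n → ℝ} {θ : Param n} (hθ : IsPos θ)
    (h : θ ≤ iterMap (rowStat w) (colStat w) θ) :
    divergence w θ ≤ ∑ i : Fin n, ∑ _j ∈ Finset.univ.erase i, (2 : ℝ) := by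
  have h1 : ∀ i, 0 ≤ ∑ j ∈ Finset.univ.erase i,
      θ.1 i * (digamma (θ.1 i + θ.2 j) - digamma (θ.1 i) + Real.log (w i j)) := by
    intro i
    rw [← Finset.mul_sum]
    refine mul_nonneg (hθ.fst i).le ?_
    have e := sum_erase_le_of_le_iterMap hn hθ h i
    rw [Finset.sum_add_distrib]
    rw [rowStat, ← neg_le_neg_iff, ← Finset.sum_neg_distrib (f := fun j => digamma (θ.1 i) - _)] at e
    simp only [neg_sub] at e
    linarith
  have h2 : ∀ j, 0 ≤ ∑ i ∈ Finset.univ.erase j,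
      θ.2 j * (digamma (θ.1 i + θ.2 j) - digamma (θ.2 j) + Real.log (1 - w i j)) := by
    intro j
    rw [← Finset.mul_sum]
    refine mul_nonneg (hθ.snd j).le ?_
    have e := sum_erase_le_of_le_iterMap (R := colStat w) (C := rowStat w) hn hθ.swap
      (by rw [iterMap_swap]; exact ⟨h.2, h.1⟩) j
    rw [Finset.sum_add_distrib]
    rw [colStat, ← neg_le_neg_iff, ← Finset.sum_neg_distrib (f := fun i => digamma (θ.swap.1 j) - _)]
      at e
    simp only [neg_sub, Prod.fst_swap, Prod.snd_swap, add_comm (θ.2 j)] at e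
    linarith
  have h3 := Finset.sum_nonneg fun i (_ : i ∈ Finset.univ) => h1 i
  have h4 := Finset.sum_nonneg fun j (_ : j ∈ Finset.univ) => h2 j
  rw [sum_erase_comm] at h4
  have h5 : ∑ i : Fin n, ∑ j ∈ Finset.univ.erase i,
      (θ.1 i * (digamma (θ.1 i + θ.2 j) - digamma (θ.1 i) + Real.log (w i j))
        + θ.2 j * (digamma (θ.1 i + θ.2 j) - digamma (θ.2 j) + Real.log (1 - w i j)))
      ≤ ∑ i : Fin n, ∑ j ∈ Finset.univ.erase i,
        (2 - edgeDivergence (w i j) (θ.1 i) (θ.2 j)) :=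
    Finset.sum_le_sum fun i _ => Finset.sum_le_sum fun j _ =>
      edge_score_le (hθ.fst i) (hθ.snd j)
  simp only [Finset.sum_add_distrib, Finset.sum_sub_distrib] at h5 h3 h4
  rw [divergence]
  simp only [mul_add, mul_sub, Finset.sum_add_distrib, Finset.sum_sub_distrib]
    at h3 h4 h5 ⊢
  linarith

/-- The off-diagonal weights lie in `(0, 1)`, and they are not all of the form `a i / (a i + b j)`:
the odds `w / (1 - w)` have different products over the two perfect matchings of a hexagon. -/
structure IsNondegenerate (w : Fin n → Fin n → ℝ) : Prop where
  pos : ∀ i j, i ≠ j → 0 < w i j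
  lt_one : ∀ i j, i ≠ j → w i j < 1
  exists_hexagon : ∃ i j k, i ≠ j ∧ i ≠ k ∧ j ≠ k ∧
    (1 - w i j) * ((1 - w k i) * (1 - w j k) * (w k j * w j i * w i k))
      ≠ w i j * (w k i * w j k * ((1 - w k j) * (1 - w j i) * (1 - w i k)))

theorem exists_ne_ne (hn : 3 ≤ n) (i k : Fin n) : ∃ j, j ≠ i ∧ j ≠ k := by
  have h : (({i, k} : Finset (Fin n))ᶜ).Nonempty := by
    rw [← Finset.card_pos, Finset.card_compl, Fintype.card_fin]
    have := Finset.card_le_two (a := i) (b := k)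
    lia
  obtain ⟨j, hj⟩ := h
  exact ⟨j, by simpa using hj⟩

/-- If all odds were `bⱼ`-to-`aᵢ` ratios, both matchings of the hexagon would give the same product,
as each uses every index once as row and once as column. -/
theorem IsNondegenerate.not_forall {w : Fin n → Fin n → ℝ} (hw : IsNondegenerate w) {θ : Param n}
    (hθ : IsPos θ) : ¬ ∀ i j, i ≠ j → θ.1 i * (1 - w i j) = θ.2 j * w i j := by
  intro h
  obtain ⟨i, j, k, hij, hik, hjk, hne⟩ := hw.exists_hexagon
  have hA : 0 < θ.1 i * θ.1 j * θ.1 k :=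
    mul_pos (mul_pos (hθ.fst i) (hθ.fst j)) (hθ.fst k)
  refine hne (mul_left_cancel₀ hA.ne' ?_)
  calc θ.1 i * θ.1 j * θ.1 k
        * ((1 - w i j) * ((1 - w k i) * (1 - w j k) * (w k j * w j i * w i k)))
      = (θ.1 i * (1 - w i j)) * (θ.1 k * (1 - w k i)) * (θ.1 j * (1 - w j k))
        * (w k j * w j i * w i k) := by ring
    _ = (θ.2 j * w k j) * (θ.2 i * w j i) * (θ.2 k * w i k) * (w i j * w k i * w j k) := by
      rw [h i j hij, h k i hik.symm, h j k hjk]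
      ring
    _ = _ := by
      rw [← h k j hjk.symm, ← h j i hij.symm, ← h i k hik]
      ring

/-- If the sum vanishes, every edge is an equality case, so `aᵢ > 0` iff `bⱼ > 0` for `i ≠ j`. With
three indices this spreads one positive coordinate to all, contradicting the hexagon. -/
theorem IsNondegenerate.divergence_pos (hn : 3 ≤ n) {w : Fin n → Fin n → ℝ}
    (hw : IsNondegenerate w) {θ : Param n} (hθ : 0 ≤ θ) (hne : θ ≠ 0) : 0 < divergence w θ := by
  have hnn : ∀ i, ∀ j ∈ Finset.univ.erase i, 0 ≤ edgeDivergence (w i j) (θ.1 i) (θ.2 j) := by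
    intro i j hj
    have hij : i ≠ j := (Finset.ne_of_mem_erase hj).symm
    exact edgeDivergence_nonneg (hw.pos i j hij) (hw.lt_one i j hij) (hθ.1 i) (hθ.2 j)
  have hnn' : ∀ i ∈ Finset.univ, 0 ≤ ∑ j ∈ Finset.univ.erase i,
      edgeDivergence (w i j) (θ.1 i) (θ.2 j) := fun i _ => Finset.sum_nonneg (hnn i)
  refine lt_of_le_of_ne (Finset.sum_nonneg hnn') fun h0 => ?_
  have heq : ∀ i j, i ≠ j → θ.1 i * (1 - w i j) = θ.2 j * w i j := by
    intro i j hij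
    have h1 := (Finset.sum_eq_zero_iff_of_nonneg hnn').1 h0.symm i (Finset.mem_univ i)
    have h2 := (Finset.sum_eq_zero_iff_of_nonneg (hnn i)).1 h1 j
      (Finset.mem_erase.2 ⟨hij.symm, Finset.mem_univ j⟩)
    exact mul_one_sub_eq_of_edgeDivergence_eq_zero (hw.pos i j hij) (hw.lt_one i j hij)
      (hθ.1 i) (hθ.2 j) h2
  have hab : ∀ i j, i ≠ j → 0 < θ.1 i → 0 < θ.2 j := by
    intro i j hij hi
    have h1 := mul_pos hi (sub_pos.2 (hw.lt_one i j hij))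
    rw [heq i j hij] at h1
    exact pos_of_mul_pos_left h1 (hw.pos i j hij).le
  have hba : ∀ i j, i ≠ j → 0 < θ.2 j → 0 < θ.1 i := by
    intro i j hij hj
    have h1 := mul_pos hj (hw.pos i j hij)
    rw [← heq i j hij] at h1
    exact pos_of_mul_pos_left h1 (sub_pos.2 (hw.lt_one i j hij)).le
  have hall : ∀ i, 0 < θ.1 i → IsPos θ := by
    intro i hi
    have ha : ∀ k, 0 < θ.1 k := by
      intro k
      obtain ⟨j, hji, hjk⟩ := exists_ne_ne hn i k
      exact hba k j hjk.symm (hab i j hji.symm hi)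
    refine ⟨ha, fun j => ?_⟩
    obtain ⟨k, hk, -⟩ := exists_ne_ne hn j j
    exact hab k j hk (ha k)
  have hex : ∃ i, 0 < θ.1 i := by
    by_contra! hle
    have ha : ∀ i, θ.1 i = 0 := fun i => le_antisymm (hle i) (hθ.1 i)
    refine hne (Prod.ext (funext ha) (funext fun j => le_antisymm ?_ (hθ.2 j)))
    by_contra! hj
    obtain ⟨k, hk, -⟩ := exists_ne_ne hn j j
    exact (hba k j hk hj).ne' (ha k)
  obtain ⟨i, hi⟩ := hex
  exact hw.not_forall (hall i hi) heq

/-- Minimise over the compact part of the unit sphere in the closed cone, then use homogeneity. -/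
theorem IsNondegenerate.exists_mul_norm_le (hn : 3 ≤ n) {w : Fin n → Fin n → ℝ}
    (hw : IsNondegenerate w) :
    ∃ m, 0 < m ∧ ∀ θ : Param n, 0 ≤ θ → m * ‖θ‖ ≤ divergence w θ := by
  have : Nonempty (Fin n) := ⟨⟨0, by lia⟩⟩
  have hK : IsCompact (Metric.sphere (0 : Param n) 1 ∩ Set.Ici 0) :=
    (isCompact_sphere _ _).inter_right isClosed_Ici
  obtain ⟨θ₀, hθ₀, hmin⟩ := hK.exists_isMinOn
    ⟨constParam n 1, by simp [constParam, Prod.norm_def], fun _ => zero_le_one, fun _ => zero_le_one⟩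
    (continuous_divergence w).continuousOn
  have hne : θ₀ ≠ 0 := by
    rintro rfl
    simpa using hθ₀.1
  refine ⟨divergence w θ₀, hw.divergence_pos hn hθ₀.2 hne, fun θ hθ => ?_⟩
  rcases eq_or_ne θ 0 with rfl | hθ0
  · simp [divergence, edgeDivergence]
  have hpos : 0 < ‖θ‖ := norm_pos_iff.2 hθ0
  have h1 : divergence w θ₀ ≤ divergence w (‖θ‖⁻¹ • θ) :=
    hmin ⟨by simp [norm_smul, hpos.ne'], smul_nonneg (inv_nonneg.2 hpos.le) hθ⟩
  rw [divergence_smul (inv_ne_zero hpos.ne'), ← div_eq_inv_mul, le_div_iff₀ hpos] at h1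
  exact h1

theorem IsNondegenerate.exists_isMLSolution (hn : 3 ≤ n) {w : Fin n → Fin n → ℝ}
    (hw : IsNondegenerate w) : ∃ θ, IsMLSolution (rowStat w) (colStat w) θ := by
  have hn2 : 2 ≤ n := by lia
  obtain ⟨ε, hε, hM⟩ := exists_digamma_two_mul_sub_ge (maxStat (rowStat w) (colStat w))
  obtain ⟨m, hm, hle⟩ := hw.exists_mul_norm_le hn
  have hmono := iterate_monotone hn2 hε hM
  obtain ⟨B, hB⟩ : ∃ B, ∀ k, ‖iterate (rowStat w) (colStat w) ε k‖ ≤ B := by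
    refine ⟨(∑ i : Fin n, ∑ _j ∈ Finset.univ.erase i, (2 : ℝ)) / m, fun k => ?_⟩
    have hp := iterate_isPos (R := rowStat w) (C := colStat w) hε k
    rw [le_div_iff₀' hm]
    refine (hle _ ⟨fun i => (hp.fst i).le, fun i => (hp.snd i).le⟩).trans
      (divergence_le hn2 hp ?_)
    rw [← iterate_succ]
    exact hmono (Nat.le_succ k)
  obtain ⟨L, hL, -⟩ := exists_tendsto_iterate hn2 hε hmono (B := constParam n B) fun k =>
    ⟨fun i => (Real.le_norm_self _).trans (((norm_le_pi_norm _ i).trans (norm_fst_le _)).trans (hB k)),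
      fun i => (Real.le_norm_self _).trans (((norm_le_pi_norm _ i).trans (norm_snd_le _)).trans (hB k))⟩
  exact ⟨L, hL⟩

end Existence

end BetaGraph

namespace BetaGraph

/-! ### Almost sure nondegeneracy of beta weights. -/

section Random

theorem betaMeasure_ae_mem_Ioo (α β : ℝ) : ∀ᵐ x ∂betaMeasure α β, x ∈ Set.Ioo (0 : ℝ) 1 := by
  rw [ae_iff]
  change betaMeasure α β (Set.Ioo 0 1)ᶜ = 0
  rw [betaMeasure, withDensity_apply _ measurableSet_Ioo.compl]
  refine setLIntegral_eq_zero measurableSet_Ioo.compl fun x hx => ?_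
  rcases le_or_gt x 0 with h | h
  · exact betaPDF_eq_zero_of_nonpos h
  · exact betaPDF_eq_zero_of_one_le (not_lt.1 fun h1 => hx ⟨h, h1⟩)

theorem betaMeasure_singleton (α β x : ℝ) : betaMeasure α β {x} = 0 :=
  withDensity_absolutelyContinuous _ _ Real.volume_singleton

/-- By Fubini: for each value of `Y`, the atomless `X` must hit a single point. -/
theorem ae_ne_of_indepFun {Ω E : Type*} [MeasurableSpace Ω] [MeasurableSpace E] {P : Measure Ω}
    [IsProbabilityMeasure P] {X : Ω → ℝ} {Y : Ω → E} (hX : AEMeasurable X P)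
    (hY : AEMeasurable Y P) (hind : IndepFun X Y P) (hat : ∀ x, P.map X {x} = 0) {g : E → ℝ}
    (hg : Measurable g) : ∀ᵐ ω ∂P, X ω ≠ g (Y ω) := by
  have : IsProbabilityMeasure (P.map X) := Measure.isProbabilityMeasure_map hX
  have : IsProbabilityMeasure (P.map Y) := Measure.isProbabilityMeasure_map hY
  have hs : MeasurableSet {p : E × ℝ | p.2 = g p.1} :=
    measurableSet_eq_fun measurable_snd (hg.comp measurable_fst)
  have h0 : (P.map fun ω => (Y ω, X ω)) {p : E × ℝ | p.2 = g p.1} = 0 := by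
    rw [(indepFun_iff_map_prod_eq_prod_map_map hY hX).1 hind.symm, Measure.measure_prod_null hs]
    exact Eventually.of_forall fun y => hat (g y)
  refine ae_of_ae_map (p := fun p : E × ℝ => p.2 ≠ g p.1) (hY.prodMk hX) ?_
  rw [ae_iff]
  simpa using h0

variable {Ω : Type*} [MeasurableSpace Ω] {n : ℕ} {P : Measure Ω} {a b : Fin n → ℝ}
  {W : Fin n → Fin n → Ω → ℝ}

theorem IsBetaModel.ae_mem_Ioo (h : IsBetaModel P a b W) :
    ∀ᵐ ω ∂P, ∀ i j, i ≠ j → W i j ω ∈ Set.Ioo (0 : ℝ) 1 := by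
  refine ae_all_iff.2 fun i => ae_all_iff.2 fun j => ?_
  by_cases hij : i = j
  · exact Eventually.of_forall fun ω hne => absurd hij hne
  have hl := h.law i j hij
  have h1 : ∀ᵐ x ∂P.map (W i j), x ∈ Set.Ioo (0 : ℝ) 1 := by
    rw [hl.map_eq]
    exact betaMeasure_ae_mem_Ioo _ _
  filter_upwards [ae_of_ae_map hl.aemeasurable h1] with ω hω _ using hω

/-- The hexagon identity is linear in `w i j`: `(1 - w i j) p = w i j q`, with `p, q > 0` depending
only on other edges. It thus forces `w i j = p / (p + q)`, a function of independent variables. -/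
theorem IsBetaModel.ae_isNondegenerate [IsProbabilityMeasure P] (hn : 3 ≤ n)
    (h : IsBetaModel P a b W) : ∀ᵐ ω ∂P, IsNondegenerate fun i j => W i j ω := by
  obtain ⟨i, j, k, hij, hik, hjk⟩ : ∃ i j k : Fin n, i ≠ j ∧ i ≠ k ∧ j ≠ k :=
    ⟨⟨0, by lia⟩, ⟨1, by lia⟩, ⟨2, by lia⟩, by simp, by simp, by simp⟩
  let e : {e : Fin n × Fin n // e.1 ≠ e.2} := ⟨(i, j), hij⟩
  let T : Finset {e : Fin n × Fin n // e.1 ≠ e.2} := Finset.univ.erase e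
  have hT : ∀ p q : Fin n, ∀ hpq : p ≠ q, (p, q) ≠ (i, j) →
      (⟨(p, q), hpq⟩ : {e : Fin n × Fin n // e.1 ≠ e.2}) ∈ T := fun p q hpq hne =>
    Finset.mem_erase.2 ⟨fun he => hne (congrArg Subtype.val he), Finset.mem_univ _⟩
  have hmeas : ∀ e : {e : Fin n × Fin n // e.1 ≠ e.2}, AEMeasurable (W e.1.1 e.1.2) P :=
    fun e => (h.law _ _ e.2).aemeasurable
  have hind := h.indep.indepFun_finset₀ {e} T (by simp [T]) hmeas
  have hind' : IndepFun (W i j) (fun ω (t : T) => W t.1.1.1 t.1.1.2 ω) P :=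
    hind.comp (φ := fun f : ({e} : Finset _) → ℝ => f ⟨e, Finset.mem_singleton_self e⟩) (ψ := id)
      (by fun_prop) measurable_id
  let y : ∀ p q : Fin n, ∀ hpq : p ≠ q, (p, q) ≠ (i, j) → (T → ℝ) → ℝ := fun p q hpq hne f =>
    f ⟨_, hT p q hpq hne⟩
  have hy : ∀ p q hpq hne, Measurable (y p q hpq hne) := fun p q hpq hne => measurable_pi_apply _
  have nki : (k, i) ≠ (i, j) := by simp [hik.symm]
  have njk : (j, k) ≠ (i, j) := by simp [hij.symm]
  have nkj : (k, j) ≠ (i, j) := by simp [hik.symm]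
  have nji : (j, i) ≠ (i, j) := by simp [hij.symm]
  have nik : (i, k) ≠ (i, j) := by simp [hjk.symm]
  let p : (T → ℝ) → ℝ := fun f => (1 - y k i hik.symm nki f) * (1 - y j k hjk njk f)
    * (y k j hjk.symm nkj f * y j i hij.symm nji f * y i k hik nik f)
  let q : (T → ℝ) → ℝ := fun f => y k i hik.symm nki f * y j k hjk njk f
    * ((1 - y k j hjk.symm nkj f) * (1 - y j i hij.symm nji f) * (1 - y i k hik nik f))
  have hp : Measurable p := by fun_prop
  have hq : Measurable q := by fun_prop
  have hne := ae_ne_of_indepFun (h.law i j hij).aemeasurable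
    (aemeasurable_pi_lambda _ fun t : T => hmeas t.1) hind'
    (fun x => by rw [(h.law i j hij).map_eq]; exact betaMeasure_singleton _ _ _)
    (hp.div (hp.add hq))
  filter_upwards [hne, h.ae_mem_Ioo] with ω hω hω01
  refine ⟨fun i j hij => (hω01 i j hij).1, fun i j hij => (hω01 i j hij).2,
    i, j, k, hij, hik, hjk, fun heq => hω ?_⟩
  have pos : ∀ p q : Fin n, p ≠ q → 0 < W p q ω := fun p q hpq => (hω01 p q hpq).1
  have pos' : ∀ p q : Fin n, p ≠ q → 0 < 1 - W p q ω := fun p q hpq => sub_pos.2 (hω01 p q hpq).2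
  have hpp : 0 < p fun t => W t.1.1.1 t.1.1.2 ω :=
    mul_pos (mul_pos (pos' _ _ hik.symm) (pos' _ _ hjk))
      (mul_pos (mul_pos (pos _ _ hjk.symm) (pos _ _ hij.symm)) (pos _ _ hik))
  have hqp : 0 < q fun t => W t.1.1.1 t.1.1.2 ω :=
    mul_pos (mul_pos (pos _ _ hik.symm) (pos _ _ hjk))
      (mul_pos (mul_pos (pos' _ _ hjk.symm) (pos' _ _ hij.symm)) (pos' _ _ hik))
  have heq' : (1 - W i j ω) * p (fun t => W t.1.1.1 t.1.1.2 ω)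
      = W i j ω * q (fun t => W t.1.1.1 t.1.1.2 ω) := heq
  simp only [Pi.div_apply, Pi.add_apply]
  rw [eq_div_iff (add_pos hpp hqp).ne']
  linarith

end Random

end BetaGraph

theorem theorem3 (n : ℕ) (hn : 2 ≤ n) :
    -- almost surely, the ML equations have exactly one solution
    (3 ≤ n → ∀ {Ω : Type*} [MeasurableSpace Ω] (P : Measure Ω) [IsProbabilityMeasure P]
        (a b : Fin n → ℝ) (W : Fin n → Fin n → Ω → ℝ), BetaGraph.IsBetaModel P a b W →
      ∀ᵐ ω ∂P, ∃! θ : BetaGraph.Param n,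
        BetaGraph.IsMLSolution (BetaGraph.rowStat fun i j => W i j ω)
          (BetaGraph.colStat fun i j => W i j ω) θ) ∧
    -- whenever the ML equations have a solution, it is unique and the iteration finds it
    (∀ (R C : Fin n → ℝ) (θhat : BetaGraph.Param n), BetaGraph.IsMLSolution R C θhat →
      (∀ θ : BetaGraph.Param n, BetaGraph.IsMLSolution R C θ → θ = θhat) ∧
      (∃! ε : ℝ, BetaGraph.IsStart R C ε) ∧
      ∀ ε : ℝ, BetaGraph.IsStart R C ε →
        Monotone (BetaGraph.iterate R C ε) ∧
        (∀ k, BetaGraph.iterate R C ε k ≤ θhat) ∧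
        Tendsto (BetaGraph.iterate R C ε) atTop (𝓝 θhat) ∧
        ∃ K q : ℝ, 0 < q ∧ q < 1 ∧
          ∀ k, ‖BetaGraph.iterate R C ε k - θhat‖ ≤ K * q ^ k) := by
  refine ⟨fun hn3 Ω _ P _ a b W hW => ?_, fun R C θhat h => ⟨fun θ hθ => h.unique hn hθ,
    h.existsUnique_isStart hn, fun ε hε => ?_⟩⟩
  · filter_upwards [hW.ae_isNondegenerate hn3] with ω hω
    obtain ⟨θ, hθ⟩ := hω.exists_isMLSolution hn3
    exact ⟨θ, hθ, fun θ' hθ' => hθ.unique hn hθ'⟩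
  · have hmono := BetaGraph.iterate_monotone hn hε.1 hε.2.ge
    have hle := h.iterate_le hn hε
    -- The limit is itself a solution, so uniqueness identifies it with `θhat`.
    obtain ⟨L, hL, hlim⟩ := BetaGraph.exists_tendsto_iterate hn hε.1 hmono hle
    obtain rfl := h.unique hn hL
    exact ⟨hmono, hle, hlim, h.exists_geometric hn hε hlim⟩
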